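/- Let $\mathcal H$ be a (real or complex) Hilbert space, let $I$ be a countable set, and let $\Psi=(\psi_i)_{i\in I}$ be a family in $\mathcal H$. The analysis operator is $C_\Psi f=(\langle f,\psi_i\rangle)_{i\in I}$ with domain $\operatorname{dom}C_\Psi=\{f\in\mathcal H:(\langle f,\psi_i\rangle)_i\in\ell^2(I)\}$; the synthesis operator $D_\Psi$ is $D_\Psi c=\sum_i c_i\psi_i$, defined for those $c\in\ell^2(I)$ for which the series converges. Let $\mathcal H_\Psi=\overline{\operatorname{dom}C_\Psi}$, let $\pi$ be the orthogonal projection of $\mathcal H$ onto $\mathcal H_\Psi$, let $C_\Psi^r:\operatorname{dom}C_\Psi^r\subseteq\mathcal H_\Psi\to\ell^2(I)$ be the analysis operator of the sequence $(\pi\psi_i)_i$ in $\mathcal H_\Psi$, let $(C_\Psi^r)^*$ be its Hilbert space adjoint (an operator from $\ell^2(I)$ to $\mathcal H_\Psi$), and let $\Gamma_\Psi=(C_\Psi^r)^*C_\Psi^r$, an operator in $\mathcal H_\Psi$. A pseudo-inverse of $C_\Psi$ is a linear operator $S:\operatorname{dom}S\subseteq\ell^2(I)\to\mathcal H$ such that,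 with natural domains for compositions, $$\overline{\operatorname{ran}S}=(\ker C_\Psi)^\perp\cap\mathcal H_\Psi,\qquad \ker S=(\operatorname{ran}C_\Psi)^\perp,\qquad C_\Psi S C_\Psi=C_\Psi .$$ Assume that $\Psi$ is a lower frame sequence, i.e. there is $A>0$ with $\sqrt A\,\|f\|\le\|C_\Psi f\|$ for all $f\in\operatorname{dom}C_\Psi$. Then $\Gamma_\Psi$ is a bijection of $\operatorname{dom}\Gamma_\Psi$ onto $\mathcal H_\Psi$, so that the canonical dual $\widetilde\Psi=(\Gamma_\Psi^{-1}\pi\psi_i)_{i\in I}$ is well defined, and $C_\Psi$ has exactly one pseudo-inverse $C_\Psi^\dagger$. It is a bounded operator defined on all of $\ell^2(I)$, and $$C_\Psi^\dagger c=\Gamma_\Psi^{-1}(C_\Psi^r)^*c\qquad\text{for all } c\in\operatorname{dom}(C_\Psi^r)^* ,$$ where $\operatorname{dom}(C_\Psi^r)^*=\operatorname{dom}\bigl(\Gamma_\Psi^{-1}(C_\Psi^r)^*\bigr)$ is dense in $\ell^2(I)$, and $C_\Psi^\dagger$ is the closure of $\Gamma_\Psi^{-1}(C_\Psi^r)^*$.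 In particular, for every $c\in\operatorname{dom}(C_\Psi^r)^*$ the series $D_{\widetilde\Psi}c$ converges (unconditionally) and $C_\Psi^\dagger c=D_{\widetilde\Psi}c$. -/

import Mathlib

noncomputable section

/-- The composition `g ∘ f` of two partially defined operators on its natural domain
`{x ∈ dom f | f x ∈ dom g}`. -/
def LinearPMap.natComp {R E F G : Type*} [Ring R] [AddCommGroup E] [Module R E]
    [AddCommGroup F] [Module R F] [AddCommGroup G] [Module R G]
    (g : F →ₗ.[R] G) (f : E →ₗ.[R] F) : E →ₗ.[R] G where
  domain := (g.domain.comap f.toFun).map f.domain.subtype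
  toFun :=
    { toFun := fun x => g ⟨f ⟨x.1, by
          obtain ⟨y, -, hy⟩ := x.2
          exact hy ▸ y.2⟩, by
          obtain ⟨x, ⟨y, hy, rfl⟩⟩ := x
          exact hy⟩
      map_add' := fun x y => by
        rw [← g.map_add]
        refine congrArg g (Subtype.ext ?_)
        exact f.map_add ⟨x.1, _⟩ ⟨y.1, _⟩
      map_smul' := fun c x => by
        rw [RingHom.id_apply, ← g.map_smul]
        refine congrArg g (Subtype.ext ?_)
        exact f.map_smul c ⟨x.1, _⟩ }

/-- The range `ran T` of a partially defined operator. -/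
def LinearPMap.ran {R E F : Type*} [Ring R] [AddCommGroup E] [Module R E]
    [AddCommGroup F] [Module R F] (T : E →ₗ.[R] F) : Submodule R F :=
  LinearMap.range T.toFun

/-- The null space `ker T = {x ∈ dom T | T x = 0}` of a partially defined operator, as a subspace
of the ambient space. -/
def LinearPMap.nullSpace {R E F : Type*} [Ring R] [AddCommGroup E] [Module R E]
    [AddCommGroup F] [Module R F] (T : E →ₗ.[R] F) : Submodule R E :=
  (LinearMap.ker T.toFun).map T.domain.subtype

/-- `S` is a pseudo-inverse of the closed, not necessarily densely defined, operator `T`. The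
operator is regarded as a densely defined operator on the Hilbert space `closure (dom T)`, so that
`(ker T)ᗮ` is taken inside this space. -/
structure LinearPMap.IsPseudoInverse {𝕜 E F : Type*} [RCLike 𝕜]
    [NormedAddCommGroup E] [InnerProductSpace 𝕜 E]
    [NormedAddCommGroup F] [InnerProductSpace 𝕜 F]
    (T : E →ₗ.[𝕜] F) (S : F →ₗ.[𝕜] E) : Prop where
  closure_ran : S.ran.topologicalClosure = T.nullSpaceᗮ ⊓ T.domain.topologicalClosure
  nullSpace_eq : S.nullSpace = T.ranᗮ
  comp_comp : T.natComp (S.natComp T) = T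

namespace FrameTheory

/-- The space `ℓ²(I)` of square-summable scalar families. -/
abbrev ellTwo (𝕜 : Type*) [RCLike 𝕜] (I : Type*) : Type _ := lp (fun _ : I => 𝕜) 2

/-- The analysis operator `C_Ψ f = (⟨f, ψ_i⟩)_i` with `dom C_Ψ = {f | (⟨f, ψ_i⟩)_i ∈ ℓ²}`.
The scalar product `⟨f, ψ_i⟩`, linear in `f`, is `inner 𝕜 (Ψ i) f` in Mathlib. -/
def analysisOp (𝕜 : Type*) [RCLike 𝕜] {I : Type*} {H : Type*} [NormedAddCommGroup H]
    [InnerProductSpace 𝕜 H] (Ψ : I → H) : H →ₗ.[𝕜] ellTwo 𝕜 I where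
  domain :=
    { carrier := {f | Memℓp (fun i => inner 𝕜 (Ψ i) f) 2}
      zero_mem' := by
        simp only [Set.mem_ofPred_eq, inner_zero_right]
        exact zero_memℓp
      add_mem' := fun {f g} hf hg => by
        simp only [Set.mem_ofPred_eq, inner_add_right] at *
        exact hf.add hg
      smul_mem' := fun c f hf => by
        simp only [Set.mem_ofPred_eq, inner_smul_right] at *
        exact hf.const_smul c }
  toFun :=
    { toFun := fun f => ⟨fun i => inner 𝕜 (Ψ i) (f : H), f.2⟩
      map_add' := fun f g => by
        ext i
        exact inner_add_right _ _ _
      map_smul' := fun c f => by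
        ext i
        exact inner_smul_right _ _ _ }

/-- The synthesis operator `D_Ψ c = ∑ i, c_i ψ_i`, defined on all `c ∈ ℓ²` for which the series
converges. The index set carries no order, so convergence is unconditional convergence. -/
def synthesisOp (𝕜 : Type*) [RCLike 𝕜] {I : Type*} {H : Type*} [NormedAddCommGroup H]
    [InnerProductSpace 𝕜 H] (Ψ : I → H) : ellTwo 𝕜 I →ₗ.[𝕜] H where
  domain :=
    { carrier := {c | Summable fun i => c i • Ψ i}
      zero_mem' := by
        simp
      add_mem' := fun {c d} hc hd => by
        simp only [Set.mem_ofPred_eq, lp.coeFn_add, Pi.add_apply, add_smul] at *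
        exact hc.add hd
      smul_mem' := fun a c hc => by
        simp only [Set.mem_ofPred_eq, lp.coeFn_smul, Pi.smul_apply, smul_assoc] at *
        exact hc.const_smul a }
  toFun :=
    { toFun := fun c => ∑' i, c.1 i • Ψ i
      map_add' := fun c d => by
        have hc : Summable fun i => c.1 i • Ψ i := c.2
        have hd : Summable fun i => d.1 i • Ψ i := d.2
        rw [← hc.tsum_add hd]
        simp [add_smul]
      map_smul' := fun a c => by
        have hc : Summable fun i => c.1 i • Ψ i := c.2
        rw [RingHom.id_apply, ← hc.tsum_const_smul a]
        simp [mul_smul] }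

/-- `Ψ` is a lower frame sequence: `√A ‖f‖ ≤ ‖C_Ψ f‖` on `dom C_Ψ` for some `A > 0`. -/
def IsLowerFrameSequence (𝕜 : Type*) [RCLike 𝕜] {I : Type*} {H : Type*} [NormedAddCommGroup H]
    [InnerProductSpace 𝕜 H] (Ψ : I → H) : Prop :=
  ∃ A : ℝ, 0 < A ∧
    ∀ f : (analysisOp 𝕜 Ψ).domain, Real.sqrt A * ‖(f : H)‖ ≤ ‖analysisOp 𝕜 Ψ f‖

/-- The Hilbert space `H_Ψ`, the closure of `dom C_Ψ` in `H`. -/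
abbrev frameSpace (𝕜 : Type*) [RCLike 𝕜] {I : Type*} {H : Type*} [NormedAddCommGroup H]
    [InnerProductSpace 𝕜 H] (Ψ : I → H) : Submodule 𝕜 H :=
  (analysisOp 𝕜 Ψ).domain.topologicalClosure

/-- The sequence `π Ψ` in `H_Ψ`, where `π` is the orthogonal projection of `H` onto `H_Ψ`. -/
def projSeq (𝕜 : Type*) [RCLike 𝕜] {I : Type*} {H : Type*} [NormedAddCommGroup H]
    [InnerProductSpace 𝕜 H] [CompleteSpace H] (Ψ : I → H) : I → frameSpace 𝕜 Ψ :=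
  fun i => (frameSpace 𝕜 Ψ).orthogonalProjectionOnto (Ψ i)

/-- The restricted analysis operator `C_Ψ^r : dom C_Ψ^r ⊆ H_Ψ → ℓ²`, the analysis operator of the
sequence `π Ψ` in `H_Ψ`. -/
def restrictedAnalysisOp (𝕜 : Type*) [RCLike 𝕜] {I : Type*} {H : Type*} [NormedAddCommGroup H]
    [InnerProductSpace 𝕜 H] [CompleteSpace H] (Ψ : I → H) :
    frameSpace 𝕜 Ψ →ₗ.[𝕜] ellTwo 𝕜 I :=
  analysisOp 𝕜 (projSeq 𝕜 Ψ)

/-- The generalized frame operator `Γ_Ψ = (C_Ψ^r)^* C_Ψ^r` in `H_Ψ`. -/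
def genFrameOp (𝕜 : Type*) [RCLike 𝕜] {I : Type*} {H : Type*} [NormedAddCommGroup H]
    [InnerProductSpace 𝕜 H] [CompleteSpace H] (Ψ : I → H) :
    frameSpace 𝕜 Ψ →ₗ.[𝕜] frameSpace 𝕜 Ψ :=
  (restrictedAnalysisOp 𝕜 Ψ).adjoint.natComp (restrictedAnalysisOp 𝕜 Ψ)

/-- The operator `Γ_Ψ⁻¹ (C_Ψ^r)^*`, with domain `{c ∈ dom (C_Ψ^r)^* | (C_Ψ^r)^* c ∈ dom Γ_Ψ⁻¹}`,
viewed as an operator from `ℓ²` to `H`. -/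
def invGenFrameAdjointOp (𝕜 : Type*) [RCLike 𝕜] {I : Type*} {H : Type*} [NormedAddCommGroup H]
    [InnerProductSpace 𝕜 H] [CompleteSpace H] (Ψ : I → H) : ellTwo 𝕜 I →ₗ.[𝕜] H :=
  (frameSpace 𝕜 Ψ).subtype.compPMap
    ((genFrameOp 𝕜 Ψ).inverse.natComp (restrictedAnalysisOp 𝕜 Ψ).adjoint)

open Classical in
/-- The canonical dual `Γ_Ψ⁻¹ π Ψ` of a lower frame sequence, as a sequence in `H`. (The value `0`
is for families whose projection is not in `dom Γ_Ψ⁻¹`; for a lower frame sequence `Γ_Ψ` is a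
bijection of `dom Γ_Ψ` onto `H_Ψ`.) -/
def canonicalDual (𝕜 : Type*) [RCLike 𝕜] {I : Type*} {H : Type*} [NormedAddCommGroup H]
    [InnerProductSpace 𝕜 H] [CompleteSpace H] (Ψ : I → H) : I → H :=
  fun i =>
    if h : projSeq 𝕜 Ψ i ∈ (genFrameOp 𝕜 Ψ).inverse.domain then
      ((genFrameOp 𝕜 Ψ).inverse ⟨projSeq 𝕜 Ψ i, h⟩ : H)
    else 0

end FrameTheory

end

noncomputable section

namespace LinearPMap

section NatComp

variable {R E F G : Type*} [Ring R] [AddCommGroup E] [Module R E]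
  [AddCommGroup F] [Module R F] [AddCommGroup G] [Module R G]
  {g : F →ₗ.[R] G} {f : E →ₗ.[R] F}

/-! The lower bound makes the closed operator `T = C_Ψ^r` injective with closed range. So inverting
`T` after the orthogonal projection onto `ran T` gives a bounded `B` with `B T = id` on `dom T` and
`ker B = (ran T)ᗮ` (`IsProjInverse`). Everything follows from `B`. Any pseudo-inverse must invert
`T` on `ran T` and vanish on `(ran T)ᗮ`; these span `ℓ²`, hence uniqueness. Dualizing `B T = id`
gives `T† B† = id`. Since `B†` maps into `ran T`, this yields `Γ⁻¹ = B B†`, and `B B† T† = B` on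
`dom T†`. As `T†` sends the unit vector `e_i` to `π ψ_i`, the canonical dual is `B e_i`. Continuity
of `B` gives the series, and density of the finitely supported sequences in `dom T†` gives the
closure statement. -/

theorem mem_natComp_domain {x : E} :
    x ∈ (g.natComp f).domain ↔ ∃ hx : x ∈ f.domain, f ⟨x, hx⟩ ∈ g.domain := by
  constructor
  · rintro ⟨y, hy, rfl⟩
    exact ⟨y.2, hy⟩
  · rintro ⟨hx, hy⟩
    exact ⟨⟨x, hx⟩, hy, rfl⟩

theorem natComp_apply {x : E} (h : x ∈ (g.natComp f).domain) (hx : x ∈ f.domain)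
    (hy : f ⟨x, hx⟩ ∈ g.domain) : g.natComp f ⟨x, h⟩ = g ⟨f ⟨x, hx⟩, hy⟩ := rfl

end NatComp

/-! ### Bounded inverses of closed operators that are bounded below -/

section Inverse

variable {𝕜 E F : Type*} [RCLike 𝕜]
  [NormedAddCommGroup E] [InnerProductSpace 𝕜 E]
  [NormedAddCommGroup F] [InnerProductSpace 𝕜 F]

/-- The bounded operator `B` is a left inverse of `T` that vanishes on `(ran T)ᗮ`: it maps every
vector to the preimage of its orthogonal projection onto `ran T`. -/
structure IsProjInverse (T : E →ₗ.[𝕜] F) (B : F →L[𝕜] E) : Prop where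
  left_inv : ∀ f : T.domain, B (T f) = f
  mem : ∀ c, B c ∈ T.domain
  sub_mem : ∀ c, c - T ⟨B c, mem c⟩ ∈ T.ranᗮ

theorem apply_mem_ran (T : E →ₗ.[𝕜] F) (f : T.domain) : T f ∈ T.ran := ⟨f, rfl⟩

/-- A closed operator that is bounded below has closed range. -/
theorem IsClosed.isComplete_ran [CompleteSpace E] [CompleteSpace F] {T : E →ₗ.[𝕜] F}
    (hT : T.IsClosed) {K : ℝ} (hK : ∀ f : T.domain, ‖(f : E)‖ ≤ K * ‖T f‖) :
    IsComplete (T.ran : Set F) := by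
  have : CompleteSpace T.graph := hT.isComplete.completeSpace_coe
  -- `ran T` is the image of the complete graph under the second projection. The graph carries the
  -- sup norm, so the bound below holds with constant `max K 1`.
  let p : T.graph →L[𝕜] F := (ContinuousLinearMap.snd 𝕜 E F).comp T.graph.subtypeL
  have hp : AntilipschitzWith (Real.toNNReal (max K 1)) p := by
    refine AddMonoidHomClass.antilipschitz_of_bound p fun x => ?_
    obtain ⟨⟨x₁, x₂⟩, hx⟩ := x
    obtain ⟨f, rfl, rfl⟩ := (mem_graph_iff T).1 hx
    rw [Real.coe_toNNReal _ (zero_le_one.trans (le_max_right _ _))]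
    change max ‖(f : E)‖ ‖T f‖ ≤ max K 1 * ‖T f‖
    refine max_le ((hK f).trans ?_) ?_
    · gcongr
      exact le_max_left _ _
    · exact le_mul_of_one_le_left (norm_nonneg _) (le_max_right _ _)
  have hr : Set.range p = (T.ran : Set F) := by
    ext c
    constructor
    · rintro ⟨⟨⟨x₁, x₂⟩, hx⟩, rfl⟩
      obtain ⟨f, rfl, rfl⟩ := (mem_graph_iff T).1 hx
      exact T.apply_mem_ran f
    · rintro ⟨f, rfl⟩
      exact ⟨⟨(f, T f), T.mem_graph f⟩, rfl⟩
  rw [← hr]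
  exact hp.isComplete_range p.uniformContinuous

/-- The bound gives both the injectivity of `T` and the continuity of its inverse on `ran T`.
Completeness of `ran T` supplies the orthogonal projection that extends this inverse to all of `F`.
-/
theorem IsClosed.exists_isProjInverse [CompleteSpace E] [CompleteSpace F] {T : E →ₗ.[𝕜] F}
    (hT : T.IsClosed) {K : ℝ} (hK : ∀ f : T.domain, ‖(f : E)‖ ≤ K * ‖T f‖) :
    ∃ B : F →L[𝕜] E, T.IsProjInverse B := by
  have : CompleteSpace T.ran := (hT.isComplete_ran hK).completeSpace_coe
  have hinj : Function.Injective T.toFun := by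
    refine (injective_iff_map_eq_zero _).2 fun f hf => Subtype.ext (norm_le_zero_iff.1 ?_)
    simpa [show T f = 0 from hf] using hK f
  let e : T.domain ≃ₗ[𝕜] T.ran := LinearEquiv.ofInjective T.toFun hinj
  have he (c : T.ran) : T (e.symm c) = c := congrArg Subtype.val (e.apply_symm_apply c)
  let B₀ : T.ran →L[𝕜] E := (T.domain.subtype ∘ₗ e.symm.toLinearMap).mkContinuous K fun c => by
    have := hK (e.symm c)
    rwa [he] at this
  have hB (f : T.domain) : B₀ ⟨T f, T.apply_mem_ran f⟩ = f :=
    congrArg Subtype.val (e.symm_apply_apply f)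
  refine ⟨B₀.comp T.ran.orthogonalProjectionOnto, fun f => ?_, fun c => (e.symm _).2, fun c => ?_⟩
  · rw [ContinuousLinearMap.comp_apply, ← hB f]
    congr 1
    exact T.ran.orthogonalProjectionOnto_mem_subspace_eq_self ⟨T f, T.apply_mem_ran f⟩
  · have : T ⟨B₀.comp T.ran.orthogonalProjectionOnto c, (e.symm _).2⟩ =
        T.ran.orthogonalProjectionOnto c := he _
    rw [this]
    exact T.ran.sub_starProjection_mem_orthogonal c

/-! ### Existence and uniqueness of the pseudo-inverse -/

namespace IsProjInverse

variable {T : E →ₗ.[𝕜] F} {B : F →L[𝕜] E} (h : T.IsProjInverse B)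

include h

theorem nullSpace_eq_bot : T.nullSpace = ⊥ := by
  refine (Submodule.eq_bot_iff _).2 ?_
  rintro _ ⟨f, hf, rfl⟩
  have hf' : T f = 0 := hf
  simpa [hf'] using (h.left_inv f).symm

theorem inner_apply_apply (f : T.domain) (c : F) :
    inner 𝕜 (T f) (T ⟨B c, h.mem c⟩) = inner 𝕜 (T f) c := by
  have := h.sub_mem c _ (T.apply_mem_ran f)
  rw [inner_sub_right, sub_eq_zero] at this
  exact this.symm

/-- `T (B c)` is the orthogonal projection of `c` onto `ran T`, and `T` is injective. -/
theorem apply_eq_zero_iff (c : F) : B c = 0 ↔ c ∈ T.ranᗮ := by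
  constructor
  · intro hc
    have h0 : T ⟨B c, h.mem c⟩ = 0 := by
      rw [show (⟨B c, h.mem c⟩ : T.domain) = 0 from Subtype.ext hc, T.map_zero]
    simpa [h0] using h.sub_mem c
  · intro hc
    have hz : T ⟨B c, h.mem c⟩ = 0 := by
      rw [← inner_self_eq_zero (𝕜 := 𝕜), h.inner_apply_apply]
      exact hc _ (T.apply_mem_ran _)
    simpa [hz] using (h.left_inv ⟨B c, h.mem c⟩).symm

/-- Since `B T = id` and `B` takes values in `dom T`, its range is exactly `dom T`; moreover `ker T`
is trivial. -/
theorem isPseudoInverse : T.IsPseudoInverse ((B : F →ₗ[𝕜] E).toPMap ⊤) where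
  closure_ran := by
    rw [h.nullSpace_eq_bot, Submodule.bot_orthogonal_eq_top, top_inf_eq]
    congr 1
    ext f
    constructor
    · rintro ⟨c, rfl⟩
      exact h.mem c
    · intro hf
      exact ⟨⟨T ⟨f, hf⟩, trivial⟩, h.left_inv ⟨f, hf⟩⟩
  nullSpace_eq := by
    ext c
    rw [← h.apply_eq_zero_iff]
    constructor
    · rintro ⟨d, hd, rfl⟩
      exact hd
    · intro hc
      exact ⟨⟨c, trivial⟩, hc, rfl⟩
  comp_comp := by
    have key (f : T.domain) :
        (f : E) ∈ (T.natComp (natComp ((B : F →ₗ[𝕜] E).toPMap ⊤) T)).domain :=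
      mem_natComp_domain.2 ⟨mem_natComp_domain.2 ⟨f.2, trivial⟩, h.mem (T f)⟩
    refine LinearPMap.ext (Submodule.ext fun f => ⟨fun hf => ?_, fun hf => key ⟨f, hf⟩⟩) ?_
    · exact (mem_natComp_domain.1 (mem_natComp_domain.1 hf).1).1
    · intro f hf hf'
      change T ⟨B (T ⟨f, hf'⟩), h.mem _⟩ = T ⟨f, hf'⟩
      exact congrArg T (Subtype.ext (h.left_inv ⟨f, hf'⟩))

/-- `T S T = T` and injectivity of `T` force `S T = id`, and the kernel condition forces `S = 0` on
`(ran T)ᗮ`. The splitting `c = T (B c) + (c - T (B c))` then determines `S`, including its domain.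
-/
theorem eq_of_isPseudoInverse {S : F →ₗ.[𝕜] E} (hS : T.IsPseudoInverse S) :
    S = (B : F →ₗ[𝕜] E).toPMap ⊤ := by
  have hran (f : T.domain) : ∃ hf : T f ∈ S.domain, S ⟨T f, hf⟩ = f := by
    have hf : (f : E) ∈ (T.natComp (S.natComp T)).domain := by
      rw [hS.comp_comp]
      exact f.2
    obtain ⟨h₁, h₂⟩ := mem_natComp_domain.1 hf
    obtain ⟨_, h₃⟩ := mem_natComp_domain.1 h₁
    refine ⟨h₃, ?_⟩
    have h₄ : T ⟨S ⟨T f, h₃⟩, h₂⟩ = T f :=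
      (LinearPMap.ext_iff.1 hS.comp_comp).2 (hf := hf) (hg := f.2)
    exact (h.left_inv ⟨_, h₂⟩).symm.trans ((congrArg B h₄).trans (h.left_inv f))
  have hker (c : F) (hc : c ∈ T.ranᗮ) : ∃ h' : c ∈ S.domain, S ⟨c, h'⟩ = 0 := by
    rw [← hS.nullSpace_eq] at hc
    obtain ⟨d, hd, rfl⟩ := hc
    exact ⟨d.2, hd⟩
  have key (c : F) : ∃ hc : c ∈ S.domain, S ⟨c, hc⟩ = B c := by
    obtain ⟨h₁, h₁'⟩ := hran ⟨B c, h.mem c⟩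
    obtain ⟨h₂, h₂'⟩ := hker _ (h.sub_mem c)
    have hc : c ∈ S.domain := by simpa using S.domain.add_mem h₁ h₂
    refine ⟨hc, ?_⟩
    rw [show (⟨c, hc⟩ : S.domain) = ⟨_, h₁⟩ + ⟨_, h₂⟩ from Subtype.ext (by simp), S.map_add,
      h₁', h₂', add_zero]
  refine LinearPMap.ext (Submodule.ext fun c => ⟨fun _ => trivial, fun _ => (key c).1⟩) ?_
  intro c hc _
  exact (key c).2

/-! ### The inverse of `T† T` and the identity `(T† T)⁻¹ T† = B` -/

section Adjoint

variable [CompleteSpace E]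

variable (hd : Dense (T.domain : Set E))

include hd in
/-- `T† T` is injective. -/
theorem adjoint_natComp_self_injective : Function.Injective (T.adjoint.natComp T) := by
  refine (injective_iff_map_eq_zero (T.adjoint.natComp T).toFun).2 fun f hf => Subtype.ext ?_
  obtain ⟨f, hfG⟩ := f
  obtain ⟨hfT, hfa⟩ := mem_natComp_domain.1 hfG
  have h₀ : T.adjoint ⟨T ⟨f, hfT⟩, hfa⟩ = 0 := hf
  have h₁ := adjoint_isFormalAdjoint hd ⟨T ⟨f, hfT⟩, hfa⟩ ⟨f, hfT⟩
  rw [h₀, inner_zero_left] at h₁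
  have h₂ : T ⟨f, hfT⟩ = 0 := inner_self_eq_zero.1 h₁.symm
  simpa [h₂] using (h.left_inv ⟨f, hfT⟩).symm

variable [CompleteSpace F]

/-- `B† g` lies in `ran T`: the difference `d` of the two sides is orthogonal to `ran T`, so `B d =
0`, so `d` is also orthogonal to `B† g`, and hence to itself. -/
theorem apply_apply_adjoint (g : E) :
    T ⟨B (ContinuousLinearMap.adjoint B g), h.mem _⟩ = ContinuousLinearMap.adjoint B g := by
  have hd := h.sub_mem (ContinuousLinearMap.adjoint B g)
  set d := ContinuousLinearMap.adjoint B g - T ⟨B (ContinuousLinearMap.adjoint B g), h.mem _⟩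
    with hd_def
  have h₁ : inner 𝕜 d (ContinuousLinearMap.adjoint B g) = 0 := by
    rw [ContinuousLinearMap.adjoint_inner_right, (h.apply_eq_zero_iff d).2 hd, inner_zero_left]
  have h₂ : inner 𝕜 d (T ⟨B (ContinuousLinearMap.adjoint B g), h.mem _⟩) = 0 :=
    Submodule.inner_left_of_mem_orthogonal (T.apply_mem_ran _) hd
  have h₃ : inner 𝕜 d d = 0 := by
    conv_lhs => rw [hd_def, inner_sub_right, ← hd_def, h₁, h₂, sub_zero]
  exact (sub_eq_zero.1 (inner_self_eq_zero.1 h₃)).symm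

include hd

theorem adjoint_apply_adjoint (g : E) :
    ∃ hg : ContinuousLinearMap.adjoint B g ∈ T.adjoint.domain,
      T.adjoint ⟨ContinuousLinearMap.adjoint B g, hg⟩ = g := by
  have key (x : T.domain) :
      inner 𝕜 g (x : E) = inner 𝕜 (ContinuousLinearMap.adjoint B g) (T x) := by
    rw [ContinuousLinearMap.adjoint_inner_left, h.left_inv]
  exact ⟨mem_adjoint_domain_of_exists _ ⟨g, key⟩, adjoint_apply_eq hd _ key⟩

/-- `B B†` is a right inverse of `T† T`. -/
theorem adjoint_natComp_self_apply (g : E) :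
    ∃ hg : B (ContinuousLinearMap.adjoint B g) ∈ (T.adjoint.natComp T).domain,
      T.adjoint.natComp T ⟨B (ContinuousLinearMap.adjoint B g), hg⟩ = g := by
  obtain ⟨h₁, h₂⟩ := h.adjoint_apply_adjoint hd g
  have h₃ := h.apply_apply_adjoint g
  have hmem : T ⟨B (ContinuousLinearMap.adjoint B g), h.mem _⟩ ∈ T.adjoint.domain := by
    rwa [h₃]
  refine ⟨mem_natComp_domain.2 ⟨h.mem _, hmem⟩, ?_⟩
  rw [natComp_apply _ (h.mem _) hmem]
  exact (congrArg T.adjoint (Subtype.ext h₃)).trans h₂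

theorem adjoint_natComp_self_bijective : Function.Bijective (T.adjoint.natComp T) :=
  ⟨h.adjoint_natComp_self_injective hd, fun g =>
    ⟨_, (h.adjoint_natComp_self_apply hd g).2⟩⟩

theorem inverse_adjoint_natComp_self_apply (g : E) :
    ∃ hg : g ∈ (T.adjoint.natComp T).inverse.domain,
      (T.adjoint.natComp T).inverse ⟨g, hg⟩ = B (ContinuousLinearMap.adjoint B g) := by
  obtain ⟨h₁, h₂⟩ := h.adjoint_natComp_self_apply hd g
  have hg : g ∈ (T.adjoint.natComp T).inverse.domain := by
    rw [inverse_domain]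
    exact ⟨_, h₂⟩
  have hker := LinearMap.ker_eq_bot.2 (h.adjoint_natComp_self_injective hd)
  exact ⟨hg, inverse_apply_eq hker (y := ⟨g, hg⟩) h₂⟩

/-- By `B T = id`, the vectors `B† T† c` and `c` have the same inner product with every `T f`; so
they differ by an element of `(ran T)ᗮ = ker B`. -/
theorem apply_adjoint_adjoint (c : T.adjoint.domain) :
    B (ContinuousLinearMap.adjoint B (T.adjoint c)) = B c := by
  rw [← sub_eq_zero, ← B.map_sub, h.apply_eq_zero_iff]
  rintro _ ⟨f, rfl⟩
  change inner 𝕜 (T f) _ = 0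
  rw [inner_sub_right, ContinuousLinearMap.adjoint_inner_right, h.left_inv,
    (adjoint_isFormalAdjoint hd).symm, sub_self]

theorem mem_inverse_natComp_adjoint_domain {c : F} :
    c ∈ ((T.adjoint.natComp T).inverse.natComp T.adjoint).domain ↔ c ∈ T.adjoint.domain :=
  ⟨fun hc => (mem_natComp_domain.1 hc).1, fun hc => mem_natComp_domain.2
    ⟨hc, (h.inverse_adjoint_natComp_self_apply hd _).1⟩⟩

theorem inverse_natComp_adjoint_apply
    (c : ((T.adjoint.natComp T).inverse.natComp T.adjoint).domain) :
    (T.adjoint.natComp T).inverse.natComp T.adjoint c = B c := by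
  have hc := (h.mem_inverse_natComp_adjoint_domain hd).1 c.2
  exact (h.inverse_adjoint_natComp_self_apply hd (T.adjoint ⟨c, hc⟩)).2.trans
    (h.apply_adjoint_adjoint hd ⟨c, hc⟩)

end Adjoint
end IsProjInverse
/-- An operator that agrees with a bounded operator on a dense domain has it as its closure. -/
theorem closure_eq_toPMap {P : F →ₗ.[𝕜] E} {B : F →L[𝕜] E} (hP : Dense (P.domain : Set F))
    (hB : ∀ c : P.domain, P c = B c) : P.closure = (B : F →ₗ[𝕜] E).toPMap ⊤ := by
  have hclosed : _root_.IsClosed {x : F × E | B x.1 = x.2} :=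
    isClosed_eq (by fun_prop) (by fun_prop)
  have hmem (x : F × E) : x ∈ ((B : F →ₗ[𝕜] E).toPMap ⊤).graph ↔ B x.1 = x.2 := by
    rw [mem_graph_iff]
    constructor
    · rintro ⟨c, hc, hx⟩
      rw [← hc, ← hx]
      rfl
    · exact fun hx => ⟨⟨x.1, trivial⟩, rfl, hx⟩
  have hgraph : P.graph.topologicalClosure = ((B : F →ₗ[𝕜] E).toPMap ⊤).graph := by
    refine SetLike.coe_injective (Set.Subset.antisymm ?_ ?_)
    · refine closure_minimal (fun x hx => ?_) ?_
      · obtain ⟨c, hc, hx⟩ := (mem_graph_iff P).1 hx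
        rw [SetLike.mem_coe, hmem, ← hc, ← hx, hB]
      · convert hclosed
        ext x
        exact hmem x
    · rintro x hx
      have hx' : x = (x.1, B x.1) := Prod.ext rfl ((hmem x).1 hx).symm
      rw [hx']
      -- Approximating `x.1` from `dom P` approximates `(x.1, B x.1)` by points of the graph of `P`.
      have hcont : Continuous fun c : F => (c, B c) := by fun_prop
      refine closure_mono ?_ (image_closure_subset_closure_image hcont ⟨x.1, hP x.1, rfl⟩)
      rintro _ ⟨c, hc, rfl⟩
      exact (mem_graph_iff P).2 ⟨⟨c, hc⟩, rfl, hB _⟩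
  have hcl : P.IsClosable := ⟨_, hgraph⟩
  exact eq_of_eq_graph (hcl.graph_closure_eq_closure_graph.symm.trans hgraph)

end Inverse
end LinearPMap

/-! ### Analysis operators: closedness and adjoint -/

namespace FrameTheory

variable {𝕜 : Type*} [RCLike 𝕜] {I : Type*} {H : Type*} [NormedAddCommGroup H]
    [InnerProductSpace 𝕜 H]

theorem analysisOp_apply_apply (Ψ : I → H) (f : (analysisOp 𝕜 Ψ).domain) (i : I) :
    analysisOp 𝕜 Ψ f i = inner 𝕜 (Ψ i) (f : H) := rfl

theorem mem_frameSpace {Ψ : I → H} (f : (analysisOp 𝕜 Ψ).domain) : (f : H) ∈ frameSpace 𝕜 Ψ :=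
  Submodule.le_topologicalClosure _ f.2

/-- The graph is cut out by one closed condition per index, as coordinates are continuous on `ℓ²`.
-/
theorem analysisOp_isClosed (Ψ : I → H) : (analysisOp 𝕜 Ψ).IsClosed := by
  have hset : ((analysisOp 𝕜 Ψ).graph : Set (H × ellTwo 𝕜 I)) =
      ⋂ i, {x | inner 𝕜 (Ψ i) x.1 = x.2 i} := by
    ext ⟨f, c⟩
    rw [SetLike.mem_coe, LinearPMap.mem_graph_iff, Set.mem_iInter]
    constructor
    · rintro ⟨f, rfl, rfl⟩ i
      rfl
    · intro h
      have hc : (fun i => inner 𝕜 (Ψ i) f) = c := funext h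
      exact ⟨⟨f, by
        change Memℓp (fun i => inner 𝕜 (Ψ i) f) 2
        rw [hc]
        exact c.2⟩, rfl, lp.ext hc⟩
  rw [LinearPMap.IsClosed, hset]
  refine isClosed_iInter fun i => isClosed_eq (by fun_prop) ?_
  exact (continuous_apply i).comp
    ((lp.uniformContinuous_coe (p := 2)).continuous.comp continuous_snd)

theorem single_mem_analysisOp_adjoint_domain [CompleteSpace H] [DecidableEq I] {Ψ : I → H}
    (i : I) : lp.single 2 i 1 ∈ (analysisOp 𝕜 Ψ).adjoint.domain := by
  refine LinearPMap.mem_adjoint_domain_of_exists _ ⟨Ψ i, fun f => ?_⟩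
  rw [lp.inner_single_left]
  simp [analysisOp_apply_apply]

theorem analysisOp_adjoint_single [CompleteSpace H] [DecidableEq I] {Ψ : I → H}
    (hd : Dense ((analysisOp 𝕜 Ψ).domain : Set H)) (i : I) :
    (analysisOp 𝕜 Ψ).adjoint ⟨lp.single 2 i 1, single_mem_analysisOp_adjoint_domain i⟩ = Ψ i := by
  refine LinearPMap.adjoint_apply_eq hd _ fun f => ?_
  rw [lp.inner_single_left]
  simp [analysisOp_apply_apply]

theorem hasSum_smul_single [DecidableEq I] (c : ellTwo 𝕜 I) :
    HasSum (fun i => c i • (lp.single 2 i 1 : ellTwo 𝕜 I)) c := by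
  convert lp.hasSum_single (by norm_num) c using 2 with i
  rw [← lp.single_smul, smul_eq_mul, mul_one]

/-- The adjoint domain contains the unit vectors, and so all finitely supported sequences. -/
theorem dense_analysisOp_adjoint_domain [CompleteSpace H] (Ψ : I → H) :
    Dense ((analysisOp 𝕜 Ψ).adjoint.domain : Set (ellTwo 𝕜 I)) := by
  classical
  intro c
  exact mem_closure_of_tendsto (hasSum_smul_single c) (Filter.Eventually.of_forall fun s =>
    Submodule.sum_mem _ fun i _ =>
      Submodule.smul_mem _ _ (single_mem_analysisOp_adjoint_domain i))

/-! ### The restricted analysis operator and the canonical dual -/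

section Restricted

variable [CompleteSpace H] {Ψ : I → H}

theorem inner_projSeq (i : I) (f : frameSpace 𝕜 Ψ) :
    inner 𝕜 (projSeq 𝕜 Ψ i) f = inner 𝕜 (Ψ i) (f : H) :=
  Submodule.inner_orthogonalProjectionOnto_eq_of_mem_right f (Ψ i)

theorem mem_restrictedAnalysisOp_domain {f : frameSpace 𝕜 Ψ} :
    f ∈ (restrictedAnalysisOp 𝕜 Ψ).domain ↔ (f : H) ∈ (analysisOp 𝕜 Ψ).domain := by
  change Memℓp (fun i => inner 𝕜 (projSeq 𝕜 Ψ i) f) 2 ↔ Memℓp (fun i => inner 𝕜 (Ψ i) (f : H)) 2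
  simp_rw [inner_projSeq]

theorem restrictedAnalysisOp_apply {f : frameSpace 𝕜 Ψ}
    (hf : f ∈ (restrictedAnalysisOp 𝕜 Ψ).domain) (hf' : (f : H) ∈ (analysisOp 𝕜 Ψ).domain) :
    restrictedAnalysisOp 𝕜 Ψ ⟨f, hf⟩ = analysisOp 𝕜 Ψ ⟨f, hf'⟩ :=
  lp.ext (funext fun i => inner_projSeq i f)

theorem dense_restrictedAnalysisOp_domain :
    Dense ((restrictedAnalysisOp 𝕜 Ψ).domain : Set (frameSpace 𝕜 Ψ)) := by
  have : ((restrictedAnalysisOp 𝕜 Ψ).domain : Set (frameSpace 𝕜 Ψ)) =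
      Subtype.val ⁻¹' ((analysisOp 𝕜 Ψ).domain : Set H) :=
    Set.ext fun f => mem_restrictedAnalysisOp_domain
  rw [this, Subtype.dense_iff]
  intro f hf
  refine closure_mono (fun g hg => ?_) hf
  exact ⟨⟨g, mem_frameSpace ⟨g, hg⟩⟩, hg, rfl⟩

/-- `C_Ψ` and `C_Ψ^r` have the same domain, values and range up to the inclusion of `H_Ψ` in `H`. -/
theorem isProjInverse_analysisOp {B : ellTwo 𝕜 I →L[𝕜] frameSpace 𝕜 Ψ}
    (hB : (restrictedAnalysisOp 𝕜 Ψ).IsProjInverse B) :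
    (analysisOp 𝕜 Ψ).IsProjInverse ((frameSpace 𝕜 Ψ).subtypeL.comp B) where
  left_inv f := by
    have hf : (⟨f, mem_frameSpace f⟩ : frameSpace 𝕜 Ψ) ∈ (restrictedAnalysisOp 𝕜 Ψ).domain :=
      mem_restrictedAnalysisOp_domain.2 f.2
    have h := hB.left_inv ⟨_, hf⟩
    rw [restrictedAnalysisOp_apply hf f.2] at h
    exact congrArg Subtype.val h
  mem c := mem_restrictedAnalysisOp_domain.1 (hB.mem c)
  sub_mem c := by
    have hc := hB.sub_mem c
    rw [restrictedAnalysisOp_apply _ (mem_restrictedAnalysisOp_domain.1 (hB.mem c))] at hc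
    rintro _ ⟨f, rfl⟩
    have hf : (⟨f, mem_frameSpace f⟩ : frameSpace 𝕜 Ψ) ∈ (restrictedAnalysisOp 𝕜 Ψ).domain :=
      mem_restrictedAnalysisOp_domain.2 f.2
    exact hc _ ⟨⟨_, hf⟩, restrictedAnalysisOp_apply hf f.2⟩

theorem IsLowerFrameSequence.exists_isProjInverse (hΨ : IsLowerFrameSequence 𝕜 Ψ) :
    ∃ B : ellTwo 𝕜 I →L[𝕜] frameSpace 𝕜 Ψ, (restrictedAnalysisOp 𝕜 Ψ).IsProjInverse B := by
  obtain ⟨A, hA, h⟩ := hΨ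
  refine LinearPMap.IsClosed.exists_isProjInverse (analysisOp_isClosed _) (K := (√A)⁻¹)
    fun f => ?_
  rw [inv_mul_eq_div, le_div_iff₀' (Real.sqrt_pos.2 hA)]
  have hf := mem_restrictedAnalysisOp_domain.1 f.2
  exact (h ⟨_, hf⟩).trans_eq (congrArg norm (restrictedAnalysisOp_apply f.2 hf).symm)

/-- With `T = C_Ψ^r` and `π ψ_i = T† e_i`, one has `Γ⁻¹ π ψ_i = B B† T† e_i = B e_i`. -/
theorem canonicalDual_eq [DecidableEq I] {B : ellTwo 𝕜 I →L[𝕜] frameSpace 𝕜 Ψ}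
    (hB : (restrictedAnalysisOp 𝕜 Ψ).IsProjInverse B) (i : I) :
    canonicalDual 𝕜 Ψ i = B (lp.single 2 i 1) := by
  have hd := dense_restrictedAnalysisOp_domain (𝕜 := 𝕜) (Ψ := Ψ)
  obtain ⟨h₁, h₂⟩ := hB.inverse_adjoint_natComp_self_apply hd (projSeq 𝕜 Ψ i)
  refine (dif_pos h₁).trans ?_
  refine congrArg Subtype.val (h₂.trans ?_)
  rw [← hB.apply_adjoint_adjoint hd ⟨_, single_mem_analysisOp_adjoint_domain i⟩]
  congr 2
  exact (analysisOp_adjoint_single hd i).symm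

/-- Apply the bounded operator `B` to the expansion of `c` in unit vectors; no restriction to `dom
(C_Ψ^r)^*` is needed. -/
theorem hasSum_smul_canonicalDual {B : ellTwo 𝕜 I →L[𝕜] frameSpace 𝕜 Ψ}
    (hB : (restrictedAnalysisOp 𝕜 Ψ).IsProjInverse B) (c : ellTwo 𝕜 I) :
    HasSum (fun i => c i • canonicalDual 𝕜 Ψ i) (B c : H) := by
  classical
  have := ((frameSpace 𝕜 Ψ).subtypeL.comp B).hasSum (hasSum_smul_single c)
  simpa [canonicalDual_eq hB] using this

end Restricted

end FrameTheory

end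

theorem mainTheorem12 {𝕜 : Type*} [RCLike 𝕜] {I : Type*} [Countable I] {H : Type*}
    [NormedAddCommGroup H] [InnerProductSpace 𝕜 H] [CompleteSpace H] (Ψ : I → H)
    (hΨ : FrameTheory.IsLowerFrameSequence 𝕜 Ψ) :
    -- `Γ_Ψ` is invertible as an operator in `H_Ψ`, with inverse defined on all of `H_Ψ`
    Function.Bijective (FrameTheory.genFrameOp 𝕜 Ψ) ∧
    ∃ Cdag : FrameTheory.ellTwo 𝕜 I →L[𝕜] H,
      -- the everywhere defined bounded operator `Cdag` is the unique pseudo-inverse of `C_Ψ`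
      (FrameTheory.analysisOp 𝕜 Ψ).IsPseudoInverse
        ((Cdag : FrameTheory.ellTwo 𝕜 I →ₗ[𝕜] H).toPMap ⊤) ∧
      (∀ S : FrameTheory.ellTwo 𝕜 I →ₗ.[𝕜] H,
        (FrameTheory.analysisOp 𝕜 Ψ).IsPseudoInverse S →
          S = (Cdag : FrameTheory.ellTwo 𝕜 I →ₗ[𝕜] H).toPMap ⊤) ∧
      -- `Γ_Ψ⁻¹ (C_Ψ^r)^*` has the dense domain `dom (C_Ψ^r)^*`; it agrees there with `Cdag`,
      -- and `Cdag` is its closure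
      (FrameTheory.invGenFrameAdjointOp 𝕜 Ψ).domain =
        (FrameTheory.restrictedAnalysisOp 𝕜 Ψ).adjoint.domain ∧
      Dense ((FrameTheory.restrictedAnalysisOp 𝕜 Ψ).adjoint.domain :
        Set (FrameTheory.ellTwo 𝕜 I)) ∧
      (∀ c : (FrameTheory.invGenFrameAdjointOp 𝕜 Ψ).domain,
        FrameTheory.invGenFrameAdjointOp 𝕜 Ψ c = Cdag c) ∧
      (FrameTheory.invGenFrameAdjointOp 𝕜 Ψ).closure =
        (Cdag : FrameTheory.ellTwo 𝕜 I →ₗ[𝕜] H).toPMap ⊤ ∧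
      -- on `dom (C_Ψ^r)^*` it is the synthesis operator of the canonical dual
      (∀ c ∈ (FrameTheory.restrictedAnalysisOp 𝕜 Ψ).adjoint.domain,
        ∃ hc : c ∈ (FrameTheory.synthesisOp 𝕜 (FrameTheory.canonicalDual 𝕜 Ψ)).domain,
          Cdag c = FrameTheory.synthesisOp 𝕜 (FrameTheory.canonicalDual 𝕜 Ψ) ⟨c, hc⟩) := by
  have hd := FrameTheory.dense_restrictedAnalysisOp_domain (𝕜 := 𝕜) (Ψ := Ψ)
  obtain ⟨B, hB⟩ := hΨ.exists_isProjInverse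
  have hC := FrameTheory.isProjInverse_analysisOp hB
  have hdom : (FrameTheory.invGenFrameAdjointOp 𝕜 Ψ).domain =
      (FrameTheory.restrictedAnalysisOp 𝕜 Ψ).adjoint.domain :=
    Submodule.ext fun _ => hB.mem_inverse_natComp_adjoint_domain hd
  have hdense := FrameTheory.dense_analysisOp_adjoint_domain (𝕜 := 𝕜) (FrameTheory.projSeq 𝕜 Ψ)
  let C : FrameTheory.ellTwo 𝕜 I →L[𝕜] H := (FrameTheory.frameSpace 𝕜 Ψ).subtypeL.comp B
  have happly (c : (FrameTheory.invGenFrameAdjointOp 𝕜 Ψ).domain) :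
      FrameTheory.invGenFrameAdjointOp 𝕜 Ψ c = C c :=
    congrArg Subtype.val (hB.inverse_natComp_adjoint_apply hd c)
  refine ⟨hB.adjoint_natComp_self_bijective hd, C,
    hC.isPseudoInverse, fun S hS => hC.eq_of_isPseudoInverse hS, hdom, hdense, happly,
    LinearPMap.closure_eq_toPMap (hdom ▸ hdense) happly, fun c _ => ?_⟩
  have hc := FrameTheory.hasSum_smul_canonicalDual hB c
  exact ⟨hc.summable, hc.tsum_eq.symm⟩
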